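/- Let $n$ be a positive integer, let $q$ be a prime power with $q \equiv \pm 3 \pmod 8$, and let $PSp_{6n}(q) = Sp_{6n}(q)/Z(Sp_{6n}(q))$ be the projective symplectic group of degree $6n$ over the field with $q$ elements. Then $PSp_{6n}(q)$ is a simple group, and it contains a subgroup of odd index that is not pronormal. Here a subgroup $H$ of a finite group $G$ is called pronormal in $G$ if, for every $g \in G$, the subgroups $H$ and $H^g = g^{-1}Hg$ are conjugate by an element of $\langle H, H^g \rangle$. -/

import Mathlib

/-- A subgroup `H` of a group `G` is pronormal in `G` if, for every `g` in `G`, the subgroups `H` and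
`H ^ g = g⁻¹ * H * g` are conjugate by an element of the subgroup `⟨H, H ^ g⟩` that they generate. -/
def Subgroup.IsPronormal {G : Type*} [Group G] (H : Subgroup G) : Prop :=
  ∀ g : G, ∃ x ∈ H ⊔ H.map (MulAut.conj g⁻¹).toMonoidHom,
    H.map (MulAut.conj x⁻¹).toMonoidHom = H.map (MulAut.conj g⁻¹).toMonoidHom

/-- The projective symplectic group of degree `2 * m` over `F`: the quotient of the symplectic group
`Sp_{2m}(F)`, realized by matrices with respect to a symplectic basis, by its center. -/
abbrev ProjectiveSymplecticGroup (m : ℕ) (F : Type*) [Field F] : Type _ :=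
  Matrix.symplecticGroup (Fin m) F ⧸ Subgroup.center (Matrix.symplecticGroup (Fin m) F)

/-!
Write `B` for the symplectic form on `F ^ (2m)`, `m = 3n`, and call `x ↦ x + a * B(v, x) v` the
transvection along `v`.

*Simplicity* is Iwasawa's argument, carried out with vectors instead of an action on projective
space. Transvections along the vectors of a subspace are transitive on the hyperbolic pairs of that
subspace (`exists_mem_transvectionSubgroup_smul_eq`), hence generate the symplectic group
(`transvectionSubgroup_top`). The group is primitive on lines, so a noncentral normal subgroup `N`
is transitive on lines (`LineRel.of_ne_smul`), and with the commutative group of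
transvections along a single vector it generates everything (`sup_range_transvectionHom_eq_top`). So
`N` contains the commutator subgroup, which contains every transvection because `2 ≠ 0` and `m ≥ 2`
(`transvection_mem_commutator`).

*The subgroup of odd index* is the image of `Q₈ ≀ Sₘ`, where `Q₈ ≤ SL₂(F)` acts on each of the `m`
hyperbolic planes. Counting hyperbolic pairs yields
`|Sp₂ₘ(q)| = ∏ (q ^ (2r) - 1) q ^ (2r - 1)`, and for `q ≡ ±3 mod 8` the `2`-adic valuation of
`q ^ (2r) - 1` is `3 + v₂(r)`; so the `2`-part of the order is that of `8 ^ m * m!`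
(`padicValNat_two_card`), and the index is odd.

*It is not pronormal*, already inside `SL₂(3) ≀ Sₘ`, where `SL₂(3) = Q₈ : C₃` is found among the
Hamilton quaternions, which are the `2 × 2` matrices over `F` since `-1` is a sum of two squares.
The product of the `C₃`-coordinates is a homomorphism `SL₂(3) ≀ Sₘ → C₃`, trivial on `Q₈ ≀ Sₘ` and
its conjugates. It is trivial on the normalizer too, where all `C₃`-coordinates agree and
`3 ∣ m`. Conjugation by an element outside its kernel is therefore never achieved by an element of
the subgroup that the two conjugates generate (`PermWreath.not_isPronormal_kerWreath`).
-/

/-! ### Pronormality and wreath products -/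

/-- Pronormality of an image pulls back along a homomorphism whose kernel lies in the subgroup.
In particular a subgroup that fails to be pronormal in an intermediate group, or in a central
extension, still fails in the large group, or in the central quotient. -/
theorem Subgroup.IsPronormal.of_map {W G : Type*} [Group W] [Group G] (f : W →* G)
    {H : Subgroup W} (hker : f.ker ≤ H) (h : (H.map f).IsPronormal) : H.IsPronormal := by
  have hconj : ∀ w : W, (H.map f).map (MulAut.conj (f w)⁻¹).toMonoidHom
      = (H.map (MulAut.conj w⁻¹).toMonoidHom).map f := by
    intro w
    rw [Subgroup.map_map, Subgroup.map_map]
    congr 1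
    ext y
    simp
  have hk : ∀ w : W, f.ker ≤ H.map (MulAut.conj w⁻¹).toMonoidHom := by
    intro w k hkk
    refine ⟨w * k * w⁻¹, hker (f.normal_ker.conj_mem k hkk w), ?_⟩
    simp [mul_assoc]
  intro g
  obtain ⟨x, hx, hxg⟩ := h (f g)
  rw [hconj, ← Subgroup.map_sup] at hx
  obtain ⟨x, hx, rfl⟩ := hx
  refine ⟨x, hx, ?_⟩
  rw [hconj, hconj] at hxg
  have := congrArg (Subgroup.comap f) hxg
  rwa [Subgroup.comap_map_eq, Subgroup.comap_map_eq, sup_eq_left.2 (hk x),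
    sup_eq_left.2 (hk g)] at this

/-- The wreath product of `T` with the symmetric group on `ι`. -/
abbrev PermWreath (T ι : Type*) [Group T] : Type _ :=
  (ι → T) ⋊[mulAutArrow (G := Equiv.Perm ι) (A := ι) (M := T)] Equiv.Perm ι

namespace PermWreath

variable {T C ι : Type*} [Group T] [CommGroup C]

theorem mul_left_apply (a b : PermWreath T ι) (i : ι) :
    (a * b).left i = a.left i * b.left (a.right⁻¹ i) := rfl

theorem inv_left_apply (a : PermWreath T ι) (i : ι) :
    a⁻¹.left i = (a.left ((a.right⁻¹)⁻¹ i))⁻¹ := rfl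

/-- The wreath product of the kernel of `φ` with the symmetric group, inside the wreath product
of the whole group. -/
def kerWreath (φ : T →* C) : Subgroup (PermWreath T ι) where
  carrier := {w | ∀ i, φ (w.left i) = 1}
  one_mem' i := by simp
  mul_mem' {a b} ha hb i := by
    rw [mul_left_apply, map_mul, ha i, hb _, one_mul]
  inv_mem' {a} ha i := by
    rw [inv_left_apply, map_inv, ha _, inv_one]

theorem card_kerWreath [Fintype ι] (φ : T →* C) :
    Nat.card (kerWreath (ι := ι) φ)
      = Nat.card φ.ker ^ Fintype.card ι * (Fintype.card ι).factorial := by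
  classical
  have e : kerWreath (ι := ι) φ ≃ (ι → φ.ker) × Equiv.Perm ι :=
    { toFun := fun w => (fun i => ⟨w.1.left i, w.2 i⟩, w.1.right)
      invFun := fun p => ⟨⟨fun i => p.1 i, p.2⟩, fun i => (p.1 i).2⟩
      left_inv := fun w => rfl
      right_inv := fun p => rfl }
  rw [Nat.card_congr e, Nat.card_prod, Nat.card_pi, Nat.card_eq_fintype_card (α := Equiv.Perm ι),
    Fintype.card_perm]
  simp

/-- The product of the images of the base coordinates in the commutative group `C`. It is
invariant under permuting coordinates, so it extends to the wreath product. -/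
def prodHom [Fintype ι] (φ : T →* C) : PermWreath T ι →* C where
  toFun w := ∏ i, φ (w.left i)
  map_one' := by simp
  map_mul' a b := by
    simp only [mul_left_apply, map_mul, Finset.prod_mul_distrib]
    congr 1
    exact Equiv.prod_comp (a.right⁻¹) (fun i => φ (b.left i))

/-- An element normalizing the subgroup has constant base coordinates modulo `φ.ker`: conjugate the
permutations by it. -/
theorem apply_left_eq_of_conj_mem [DecidableEq ι] {φ : T →* C} {w : PermWreath T ι}
    (hw : ∀ h ∈ kerWreath φ, w * h * w⁻¹ ∈ kerWreath (ι := ι) φ) (i j : ι) :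
    φ (w.left i) = φ (w.left j) := by
  have h1 : (SemidirectProduct.inr (w.right⁻¹ * Equiv.swap i j * w.right) : PermWreath T ι) ∈
      kerWreath (ι := ι) φ := by
    intro k
    simp
  have h2 := hw _ h1 i
  simp only [mul_left_apply, inv_left_apply, SemidirectProduct.left_inr,
    SemidirectProduct.right_inr, SemidirectProduct.mul_right, Pi.one_apply, map_mul, map_inv,
    mul_one] at h2
  simpa [← mul_assoc] using mul_inv_eq_one.1 h2

/-- If `C` is nontrivial of exponent dividing `|ι|`, the wreath product of the kernel of `φ` with
the symmetric group is not pronormal. The product homomorphism kills the subgroup and its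
conjugates, and also its normalizer, where the base coordinates are constant modulo the kernel
and their `|ι|`-th power is trivial; but it does not kill an element with a single nontrivial
coordinate. -/
theorem not_isPronormal_kerWreath [Fintype ι] [Nonempty ι] (φ : T →* C)
    (hφ : ∃ t, φ t ≠ 1) (hC : ∀ c : C, c ^ Fintype.card ι = 1) :
    ¬ (kerWreath (ι := ι) φ).IsPronormal := by
  classical
  intro hpro
  obtain ⟨t, ht⟩ := hφ
  obtain ⟨i₀⟩ := ‹Nonempty ι›
  set g : PermWreath T ι := SemidirectProduct.inl (Pi.mulSingle i₀ t) with hg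
  have hgσ : prodHom φ g = φ t := by
    simp only [prodHom, hg, MonoidHom.coe_mk, OneHom.coe_mk, SemidirectProduct.left_inl]
    rw [Finset.prod_eq_single i₀]
    · simp
    · intro j _ hj
      simp [hj]
    · simp
  obtain ⟨x, hx, hxg⟩ := hpro g
  have hker : kerWreath (ι := ι) φ ≤ (prodHom φ).ker := fun w hw =>
    Finset.prod_eq_one fun i _ => hw i
  have hxσ : prodHom φ x = 1 := by
    have : kerWreath (ι := ι) φ ⊔ (kerWreath φ).map (MulAut.conj g⁻¹).toMonoidHom
        ≤ (prodHom φ).ker := by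
      refine sup_le hker ?_
      rintro _ ⟨w, hw, rfl⟩
      exact (prodHom φ).normal_ker.conj_mem w (hker hw) g⁻¹
    exact this hx
  have hnorm : ∀ h ∈ kerWreath φ, (g * x⁻¹) * h * (g * x⁻¹)⁻¹ ∈ kerWreath (ι := ι) φ := by
    intro h hh
    have : x⁻¹ * h * x ∈ (kerWreath (ι := ι) φ).map (MulAut.conj x⁻¹).toMonoidHom :=
      ⟨h, hh, by simp⟩
    rw [hxg] at this
    obtain ⟨k, hk, hk'⟩ := this
    have : k = (g * x⁻¹) * h * (g * x⁻¹)⁻¹ := by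
      simp only [MulEquiv.coe_toMonoidHom, MulAut.conj_apply, inv_inv] at hk'
      calc k = g * (g⁻¹ * k * g) * g⁻¹ := by group
        _ = _ := by rw [hk']; group
    exact this ▸ hk
  have hconst := apply_left_eq_of_conj_mem hnorm
  have h1 : prodHom φ (g * x⁻¹) = 1 := by
    rw [show prodHom φ (g * x⁻¹) = ∏ i, φ ((g * x⁻¹).left i) from rfl,
      Finset.prod_congr rfl (fun i _ => hconst i i₀)]
    simpa using hC _
  rw [map_mul, map_inv, hxσ, hgσ] at h1
  exact ht (by simpa using h1)

end PermWreath

/-! ### The symplectic form and transvections -/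

namespace SymplecticGroup

open Matrix
open scoped commutatorElement

variable {ι F : Type*} [Fintype ι] [DecidableEq ι] [Field F]

variable (ι F) in
/-- The alternating form with Gram matrix `Matrix.J`, which the symplectic group preserves. -/
def form : LinearMap.BilinForm F (ι ⊕ ι → F) := Matrix.toBilin' (J ι F)

theorem form_eq_dotProduct (x y : ι ⊕ ι → F) : form ι F x y = x ⬝ᵥ J ι F *ᵥ y :=
  Matrix.toBilin'_apply' _ _ _

theorem form_eq_sum (x y : ι ⊕ ι → F) :
    form ι F x y = ∑ i, (x (.inr i) * y (.inl i) - x (.inl i) * y (.inr i)) := by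
  rw [form_eq_dotProduct, J, fromBlocks_mulVec]
  simp only [dotProduct, Fintype.sum_sum_type, Sum.elim_inl, Sum.elim_inr, zero_mulVec,
    neg_mulVec, one_mulVec, zero_add, add_zero, Pi.neg_apply, Function.comp_apply]
  rw [← Finset.sum_add_distrib]
  exact Finset.sum_congr rfl fun i _ => by ring

@[simp]
theorem form_self (x : ι ⊕ ι → F) : form ι F x x = 0 := by
  rw [form_eq_sum]
  exact Finset.sum_eq_zero fun i _ => by ring

theorem form_swap (x y : ι ⊕ ι → F) : form ι F y x = -form ι F x y := by
  rw [form_eq_sum, form_eq_sum, ← Finset.sum_neg_distrib]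
  exact Finset.sum_congr rfl fun i _ => by ring

theorem form_single_inl (i : ι) (y : ι ⊕ ι → F) :
    form ι F (Pi.single (.inl i) 1) y = -y (.inr i) := by
  rw [form_eq_sum, Finset.sum_eq_single i]
  · simp
  · intro j _ hj
    simp [hj]
  · simp

theorem form_single_inr (i : ι) (y : ι ⊕ ι → F) :
    form ι F (Pi.single (.inr i) 1) y = y (.inl i) := by
  rw [form_eq_sum, Finset.sum_eq_single i]
  · simp
  · intro j _ hj
    simp [hj]
  · simp

theorem form_mulVec_mulVec (A : Matrix (ι ⊕ ι) (ι ⊕ ι) F) (x y : ι ⊕ ι → F) :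
    form ι F (A *ᵥ x) (A *ᵥ y) = x ⬝ᵥ (Aᵀ * J ι F * A) *ᵥ y := by
  rw [form_eq_dotProduct, ← mulVec_mulVec, ← mulVec_mulVec, dotProduct_mulVec x, vecMul_transpose]

theorem form_smul_smul (g : symplecticGroup ι F) (x y : ι ⊕ ι → F) :
    form ι F (g • x) (g • y) = form ι F x y := by
  change form ι F (g.1 *ᵥ x) (g.1 *ᵥ y) = _
  rw [form_mulVec_mulVec, mem_iff'.1 g.2, form_eq_dotProduct]

theorem ext_smul {g h : symplecticGroup ι F} (H : ∀ x : ι ⊕ ι → F, g • x = h • x) : g = h :=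
  Subtype.ext (Matrix.ext_iff_smul.2 H)

/-- The symplectic matrix of a linear isometry of the symplectic form. -/
def ofIsometry (f : (ι ⊕ ι → F) →ₗ[F] (ι ⊕ ι → F))
    (hf : ∀ x y, form ι F (f x) (f y) = form ι F x y) : symplecticGroup ι F :=
  ⟨LinearMap.toMatrix' f, by
    rw [mem_iff']
    apply Matrix.toBilin'.injective
    refine LinearMap.ext₂ fun x y => ?_
    rw [Matrix.toBilin'_apply', Matrix.toBilin'_apply', ← form_mulVec_mulVec,
      LinearMap.toMatrix'_mulVec, LinearMap.toMatrix'_mulVec, hf, form_eq_dotProduct]⟩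

theorem ofIsometry_smul (f : (ι ⊕ ι → F) →ₗ[F] (ι ⊕ ι → F))
    (hf : ∀ x y, form ι F (f x) (f y) = form ι F x y) (x : ι ⊕ ι → F) :
    ofIsometry f hf • x = f x :=
  LinearMap.toMatrix'_mulVec f x

/-- The symplectic transvection `x ↦ x + a * B(v, x) v`. -/
def transvection (v : ι ⊕ ι → F) (a : F) : symplecticGroup ι F :=
  ofIsometry (LinearMap.id + a • (form ι F v).smulRight v) fun x y => by
    simp only [LinearMap.add_apply, LinearMap.id_apply, LinearMap.smul_apply,
      LinearMap.smulRight_apply, map_add, map_smul, form_self, smul_eq_mul, form_swap v x]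
    ring

theorem transvection_smul (v : ι ⊕ ι → F) (a : F) (x : ι ⊕ ι → F) :
    transvection v a • x = x + (a * form ι F v x) • v := by
  rw [transvection, ofIsometry_smul]
  simp [mul_smul]

theorem transvection_smul_of_form_eq_zero {v x : ι ⊕ ι → F} (a : F) (h : form ι F v x = 0) :
    transvection v a • x = x := by
  simp [transvection_smul, h]

theorem conj_transvection (g : symplecticGroup ι F) (v : ι ⊕ ι → F) (a : F) :
    g * transvection v a * g⁻¹ = transvection (g • v) a := by
  refine ext_smul fun x => ?_
  rw [mul_smul, mul_smul, transvection_smul, transvection_smul, smul_add, smul_inv_smul,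
    smul_comm g, ← form_smul_smul g v, smul_inv_smul]

/-- A transvection moves `u` to any `w` not orthogonal to it. -/
theorem transvection_sub_smul {u w : ι ⊕ ι → F} (h : form ι F u w ≠ 0) :
    transvection (w - u) (form ι F w u)⁻¹ • u = w := by
  have h' : form ι F w u ≠ 0 := by
    rw [form_swap u w]
    exact neg_ne_zero.2 h
  rw [transvection_smul]
  simp [h']

/-- The subgroup generated by the transvections along vectors of `W`. -/
def transvectionSubgroup (W : Submodule F (ι ⊕ ι → F)) : Subgroup (symplecticGroup ι F) :=
  Subgroup.closure {g | ∃ v ∈ W, ∃ a, g = transvection v a}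

theorem transvection_mem {W : Submodule F (ι ⊕ ι → F)} {v : ι ⊕ ι → F} (hv : v ∈ W) (a : F) :
    transvection v a ∈ transvectionSubgroup W :=
  Subgroup.subset_closure ⟨v, hv, a, rfl⟩

theorem smul_mem_of_mem_transvectionSubgroup {W : Submodule F (ι ⊕ ι → F)}
    {g : symplecticGroup ι F} (hg : g ∈ transvectionSubgroup W) :
    ∀ x ∈ W, g • x ∈ W := by
  have hgen : ∀ v ∈ W, ∀ a, ∀ x ∈ W, transvection v a • x ∈ W := fun v hv a x hx => by
    rw [transvection_smul]
    exact W.add_mem hx (W.smul_mem _ hv)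
  have hinv : ∀ (v : ι ⊕ ι → F) (a : F), (transvection v a)⁻¹ = transvection v (-a) := by
    intro v a
    rw [inv_eq_iff_mul_eq_one]
    refine ext_smul fun x => ?_
    rw [mul_smul, transvection_smul v (-a), transvection_smul, one_smul]
    simp
  induction hg using Subgroup.closure_induction'' with
  | mem g h =>
    obtain ⟨v, hv, a, rfl⟩ := h
    exact hgen v hv a
  | inv_mem g h =>
    obtain ⟨v, hv, a, rfl⟩ := h
    rw [hinv]
    exact hgen v hv _
  | one => simp
  | mul a b _ _ ha hb =>
    intro x hx
    rw [mul_smul]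
    exact ha _ (hb x hx)

theorem smul_eq_of_mem_transvectionSubgroup {W : Submodule F (ι ⊕ ι → F)}
    {g : symplecticGroup ι F} (hg : g ∈ transvectionSubgroup W) {x : ι ⊕ ι → F}
    (hx : ∀ v ∈ W, form ι F v x = 0) : g • x = x := by
  have : transvectionSubgroup W ≤ MulAction.stabilizer (symplecticGroup ι F) x := by
    refine (Subgroup.closure_le _).2 ?_
    rintro _ ⟨v, hv, a, rfl⟩
    exact transvection_smul_of_form_eq_zero a (hx v hv)
  exact this hg

theorem transvectionSubgroup_mono {W W' : Submodule F (ι ⊕ ι → F)} (h : W ≤ W') :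
    transvectionSubgroup W ≤ transvectionSubgroup W' :=
  Subgroup.closure_mono fun _ ⟨v, hv, a, h'⟩ => ⟨v, h hv, a, h'⟩

/-- The partners `f`, `f'` provide, without `W` being nondegenerate, an intermediate vector `z` that
is orthogonal neither to `e` nor to `e'`. -/
theorem exists_mem_transvectionSubgroup_smul_eq_of_form_eq_one {W : Submodule F (ι ⊕ ι → F)}
    {e f e' f' : ι ⊕ ι → F} (he : e ∈ W) (hf : f ∈ W) (he' : e' ∈ W) (hf' : f' ∈ W)
    (h : form ι F e f = 1) (h' : form ι F e' f' = 1) :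
    ∃ g ∈ transvectionSubgroup W, g • e = e' := by
  have key : ∀ z ∈ W, form ι F e z ≠ 0 → form ι F z e' ≠ 0 →
      ∃ g ∈ transvectionSubgroup W, g • e = e' := fun z hz h1 h2 =>
    ⟨_, mul_mem (transvection_mem (W.sub_mem he' hz) (form ι F e' z)⁻¹)
      (transvection_mem (W.sub_mem hz he) (form ι F z e)⁻¹), by
      rw [mul_smul, transvection_sub_smul h1, transvection_sub_smul h2]⟩
  have hs : ∀ z, form ι F e' z ≠ 0 → form ι F z e' ≠ 0 := fun z hz => by
    rw [form_swap e' z]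
    exact neg_ne_zero.2 hz
  by_cases h1 : form ι F e' f = 0
  · by_cases h2 : form ι F e f' = 0
    · exact key (f + f') (W.add_mem hf hf') (by simp [h, h2]) (hs _ (by simp [h', h1]))
    · exact key f' hf' h2 (hs _ (by simp [h']))
  · exact key f hf (by simp [h]) (hs _ h1)

theorem exists_mem_transvectionSubgroup_smul_eq_of_left_eq {W : Submodule F (ι ⊕ ι → F)}
    {e f f' : ι ⊕ ι → F} (he : e ∈ W) (hf : f ∈ W) (hf' : f' ∈ W)
    (h : form ι F e f = 1) (h' : form ι F e f' = 1) :
    ∃ g ∈ transvectionSubgroup W, g • e = e ∧ g • f = f' := by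
  have hfix : ∀ x y : ι ⊕ ι → F, form ι F e x = 1 → form ι F e y = 1 → ∀ a,
      transvection (y - x) a • e = e := fun x y hx hy a =>
    transvection_smul_of_form_eq_zero a (by
      rw [form_swap e]
      simp [hx, hy])
  by_cases h0 : form ι F f f' = 0
  · -- `(e, e + f)` is again a hyperbolic pair, and `e + f` is orthogonal neither to `f` nor to `f'`
    have hef : form ι F e (e + f) = 1 := by simp [h]
    have h1 : form ι F f (e + f) ≠ 0 := by simp [form_swap e f, h]
    have h2 : form ι F (e + f) f' ≠ 0 := by simp [h0, h']
    refine ⟨_, mul_mem (transvection_mem (W.sub_mem hf' (W.add_mem he hf)) (form ι F f' (e + f))⁻¹)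
      (transvection_mem (W.sub_mem (W.add_mem he hf) hf) (form ι F (e + f) f)⁻¹), ?_, ?_⟩
    · rw [mul_smul, hfix _ _ h hef, hfix _ _ hef h']
    · rw [mul_smul, transvection_sub_smul h1, transvection_sub_smul h2]
  · exact ⟨_, transvection_mem (W.sub_mem hf' hf) _, hfix _ _ h h' _, transvection_sub_smul h0⟩

/-- Transvections along vectors of `W` act transitively on the hyperbolic pairs of `W`. -/
theorem exists_mem_transvectionSubgroup_smul_eq {W : Submodule F (ι ⊕ ι → F)}
    {e f e' f' : ι ⊕ ι → F} (he : e ∈ W) (hf : f ∈ W) (he' : e' ∈ W) (hf' : f' ∈ W)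
    (h : form ι F e f = 1) (h' : form ι F e' f' = 1) :
    ∃ g ∈ transvectionSubgroup W, g • e = e' ∧ g • f = f' := by
  obtain ⟨g, hg, rfl⟩ := exists_mem_transvectionSubgroup_smul_eq_of_form_eq_one he hf he' hf' h h'
  obtain ⟨k, hk, hke, hkf⟩ := exists_mem_transvectionSubgroup_smul_eq_of_left_eq (f := g • f) he'
    (smul_mem_of_mem_transvectionSubgroup hg f hf) hf' (by rw [form_smul_smul, h]) h'
  exact ⟨k * g, mul_mem hk hg, by rw [mul_smul, hke], by rw [mul_smul, hkf]⟩

/-! ### Stabilizers of coordinate hyperbolic planes -/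

variable (F) in
/-- The vectors whose coordinates vanish on the hyperbolic planes indexed by `s`. -/
def vanishing (s : Finset ι) : Submodule F (ι ⊕ ι → F) where
  carrier := {x | ∀ i ∈ s, x (.inl i) = 0 ∧ x (.inr i) = 0}
  zero_mem' := by simp
  add_mem' {x y} hx hy i hi := by simp [hx i hi, hy i hi]
  smul_mem' c x hx i hi := by simp [hx i hi]

omit [Fintype ι] [DecidableEq ι] in
theorem mem_vanishing {s : Finset ι} {x : ι ⊕ ι → F} :
    x ∈ vanishing F s ↔ ∀ i ∈ s, x (.inl i) = 0 ∧ x (.inr i) = 0 := Iff.rfl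

omit [Fintype ι] in
theorem single_inl_mem_vanishing {s : Finset ι} {i : ι} (hi : i ∉ s) :
    (Pi.single (.inl i) 1 : ι ⊕ ι → F) ∈ vanishing F s := fun j hj => by
  have : j ≠ i := fun h => hi (h ▸ hj)
  simp [this]

omit [Fintype ι] in
theorem single_inr_mem_vanishing {s : Finset ι} {i : ι} (hi : i ∉ s) :
    (Pi.single (.inr i) 1 : ι ⊕ ι → F) ∈ vanishing F s := fun j hj => by
  have : j ≠ i := fun h => hi (h ▸ hj)
  simp [this]

/-- The restriction of the form to `vanishing F s` is nondegenerate. -/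
theorem exists_form_eq_one {s : Finset ι} {x : ι ⊕ ι → F} (hx : x ∈ vanishing F s) (h0 : x ≠ 0) :
    ∃ y ∈ vanishing F s, form ι F x y = 1 := by
  obtain ⟨j, hj⟩ := Function.ne_iff.1 h0
  have key : ∀ y ∈ vanishing F s, form ι F x y ≠ 0 → ∃ y ∈ vanishing F s, form ι F x y = 1 :=
    fun y hy h => ⟨(form ι F x y)⁻¹ • y, Submodule.smul_mem _ _ hy, by simp [h]⟩
  rcases j with i | i
  · refine key (Pi.single (.inr i) 1) (single_inr_mem_vanishing fun hi => hj (hx i hi).1) ?_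
    rw [form_swap (Pi.single (.inr i) 1), form_single_inr]
    simpa using hj
  · refine key (Pi.single (.inl i) 1) (single_inl_mem_vanishing fun hi => hj (hx i hi).2) ?_
    rw [form_swap (Pi.single (.inl i) 1), form_single_inl]
    simpa using hj

theorem card_vanishing [Finite F] (s : Finset ι) :
    Nat.card (vanishing F s) = Nat.card F ^ (2 * sᶜ.card) := by
  have e : vanishing F s ≃ ({i // i ∈ sᶜ} ⊕ {i // i ∈ sᶜ} → F) :=
    { toFun := fun x => Sum.elim (fun i => x.1 (.inl i)) (fun i => x.1 (.inr i))
      invFun := fun y => ⟨Sum.elim (fun i => if h : i ∈ sᶜ then y (.inl ⟨i, h⟩) else 0)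
        (fun i => if h : i ∈ sᶜ then y (.inr ⟨i, h⟩) else 0), fun i hi => by simp [hi]⟩
      left_inv := fun x => by
        ext (i | i)
        · by_cases h : i ∈ s
          · simp [h, (x.2 i h).1]
          · simp [h]
        · by_cases h : i ∈ s
          · simp [h, (x.2 i h).2]
          · simp [h]
      right_inv := fun y => by
        ext (i | i)
        · simp [Finset.mem_compl.1 i.2]
        · simp [Finset.mem_compl.1 i.2] }
  rw [Nat.card_congr e, Nat.card_fun]
  simp [two_mul, Finset.card_compl]

variable (F) in
/-- The pointwise stabilizer of the coordinate hyperbolic planes indexed by `s`. -/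
def planeStabilizer (s : Finset ι) : Subgroup (symplecticGroup ι F) where
  carrier := {g | ∀ i ∈ s, g • (Pi.single (.inl i) 1 : ι ⊕ ι → F) = Pi.single (.inl i) 1 ∧
    g • (Pi.single (.inr i) 1 : ι ⊕ ι → F) = Pi.single (.inr i) 1}
  one_mem' := by simp
  mul_mem' {a b} ha hb i hi := by
    simp only [mul_smul, ha i hi, hb i hi, and_self]
  inv_mem' {a} ha i hi := by
    rw [inv_smul_eq_iff, inv_smul_eq_iff, (ha i hi).1, (ha i hi).2]
    exact ⟨rfl, rfl⟩

theorem smul_mem_vanishing {s : Finset ι} {g : symplecticGroup ι F} (hg : g ∈ planeStabilizer F s)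
    {x : ι ⊕ ι → F} (hx : x ∈ vanishing F s) : g • x ∈ vanishing F s := by
  intro i hi
  have h1 := form_smul_smul g (Pi.single (.inl i) 1) x
  have h2 := form_smul_smul g (Pi.single (.inr i) 1) x
  rw [(hg i hi).1, form_single_inl, form_single_inl, (hx i hi).2] at h1
  rw [(hg i hi).2, form_single_inr, form_single_inr, (hx i hi).1] at h2
  exact ⟨h2, by simpa using h1⟩

theorem transvectionSubgroup_vanishing_le (s : Finset ι) :
    transvectionSubgroup (vanishing F s) ≤ planeStabilizer F s := by
  intro g hg i hi
  constructor <;> refine smul_eq_of_mem_transvectionSubgroup hg fun v hv => ?_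
  · rw [form_swap (Pi.single (.inl i) 1), form_single_inl, (hv i hi).2]
    simp
  · rw [form_swap (Pi.single (.inr i) 1), form_single_inr, (hv i hi).1]
    simp

theorem planeStabilizer_empty : planeStabilizer F (∅ : Finset ι) = ⊤ :=
  top_unique fun g _ i hi => by simp at hi

theorem planeStabilizer_univ : planeStabilizer F (Finset.univ : Finset ι) = ⊥ := by
  refine bot_unique fun g hg => ?_
  rw [Subgroup.mem_bot]
  refine Subtype.ext (Matrix.ext_of_mulVec_single fun j => ?_)
  rcases j with i | i
  · exact (hg i (Finset.mem_univ i)).1.trans (one_mulVec _).symm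
  · exact (hg i (Finset.mem_univ i)).2.trans (one_mulVec _).symm

/-- The standard hyperbolic pair of the plane indexed by `a` is moved by the stabilizer of the other
planes to exactly the hyperbolic pairs orthogonal to those planes. -/
theorem orbit_planeStabilizer {s : Finset ι} {a : ι} (ha : a ∉ s) :
    MulAction.orbit (planeStabilizer F s)
        ((Pi.single (.inr a) 1, Pi.single (.inl a) 1) : (ι ⊕ ι → F) × (ι ⊕ ι → F))
      = {p | p.1 ∈ vanishing F s ∧ p.2 ∈ vanishing F s ∧ form ι F p.1 p.2 = 1} := by
  have h1 : form ι F (Pi.single (.inr a) 1) (Pi.single (.inl a) 1) = 1 := by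
    simp [form_single_inr]
  ext ⟨e, f⟩
  constructor
  · rintro ⟨g, hg⟩
    obtain ⟨rfl, rfl⟩ := Prod.mk.inj hg
    exact ⟨smul_mem_vanishing g.2 (single_inr_mem_vanishing ha),
      smul_mem_vanishing g.2 (single_inl_mem_vanishing ha), (form_smul_smul g.1 _ _).trans h1⟩
  · rintro ⟨he, hf, hef⟩
    obtain ⟨g, hg, hge, hgf⟩ := exists_mem_transvectionSubgroup_smul_eq
      (single_inr_mem_vanishing ha) (single_inl_mem_vanishing ha) he hf h1 hef
    exact ⟨⟨g, transvectionSubgroup_vanishing_le s hg⟩, Prod.ext hge hgf⟩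

theorem stabilizer_planeStabilizer (s : Finset ι) (a : ι) :
    MulAction.stabilizer (planeStabilizer F s)
        ((Pi.single (.inr a) 1, Pi.single (.inl a) 1) : (ι ⊕ ι → F) × (ι ⊕ ι → F))
      = (planeStabilizer F (insert a s)).subgroupOf (planeStabilizer F s) := by
  ext g
  rw [MulAction.mem_stabilizer_iff, Subgroup.mem_subgroupOf]
  constructor
  · intro hg i hi
    obtain ⟨h1, h2⟩ := Prod.mk.inj hg
    rcases Finset.mem_insert.1 hi with rfl | hi
    · exact ⟨h2, h1⟩
    · exact g.2 i hi
  · intro hg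
    have := hg a (Finset.mem_insert_self _ _)
    exact Prod.ext this.2 this.1

/-- The symplectic group is generated by transvections. -/
theorem transvectionSubgroup_top : transvectionSubgroup (⊤ : Submodule F (ι ⊕ ι → F)) = ⊤ := by
  -- correct an isometry plane by plane until it fixes all coordinate vectors
  suffices h : ∀ s : Finset ι, planeStabilizer F sᶜ ≤ transvectionSubgroup ⊤ by
    rw [← top_le_iff]
    simpa [planeStabilizer_empty] using h Finset.univ
  intro s
  induction s using Finset.induction_on with
  | empty => simp [planeStabilizer_univ]
  | insert a s ha ih =>
    intro g hg
    set t := (insert a s)ᶜ with ht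
    have hat : a ∉ t := by simp [ht]
    have hins : insert a t = sᶜ := by
      ext i
      by_cases h : i = a
      · simp [h, ha]
      · simp [ht, h]
    have h1 : form ι F (Pi.single (.inr a) 1) (Pi.single (.inl a) 1) = 1 := by
      simp [form_single_inr]
    obtain ⟨k, hk, hke, hkf⟩ := exists_mem_transvectionSubgroup_smul_eq
      (single_inr_mem_vanishing hat) (single_inl_mem_vanishing hat)
      (smul_mem_vanishing hg (single_inr_mem_vanishing hat))
      (smul_mem_vanishing hg (single_inl_mem_vanishing hat)) h1 ((form_smul_smul g _ _).trans h1)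
    have hkg : k⁻¹ * g ∈ planeStabilizer F sᶜ := by
      rw [← hins]
      intro i hi
      rcases Finset.mem_insert.1 hi with rfl | hi
      · rw [mul_smul, mul_smul, ← hke, ← hkf, inv_smul_smul, inv_smul_smul]
        exact ⟨rfl, rfl⟩
      · exact mul_mem (inv_mem (transvectionSubgroup_vanishing_le t hk)) hg i hi
    have := mul_mem (transvectionSubgroup_mono le_top hk) (ih hkg)
    rwa [mul_inv_cancel_left] at this

/-! ### The order of the symplectic group -/

theorem card_fiber_one_mul_card {W : Type*} [AddCommGroup W] [Module F W] (ψ : W →ₗ[F] F) {x₀ : W}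
    (hx₀ : ψ x₀ = 1) : Nat.card {x // ψ x = 1} * Nat.card F = Nat.card W := by
  rw [← Nat.card_prod]
  refine Nat.card_congr
    { toFun := fun p => p.1.1 + (p.2 - 1) • x₀
      invFun := fun x => (⟨x + (1 - ψ x) • x₀, by simp [hx₀]⟩, ψ x)
      left_inv := fun p => ?_
      right_inv := fun x => ?_ }
  · have := p.1.2
    ext
    · simp only [map_add, map_smul, hx₀, this, smul_eq_mul]
      module
    · simp [hx₀, this]
  · simp only
    module

theorem card_hyperbolicPairs_mul_card [Finite F] (s : Finset ι) :
    {p : (ι ⊕ ι → F) × (ι ⊕ ι → F) | p.1 ∈ vanishing F s ∧ p.2 ∈ vanishing F s ∧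
        form ι F p.1 p.2 = 1}.ncard * Nat.card F
      = (Nat.card F ^ (2 * sᶜ.card) - 1) * Nat.card F ^ (2 * sᶜ.card) := by
  rw [← card_vanishing]
  set W := vanishing F s
  have e : {p : (ι ⊕ ι → F) × (ι ⊕ ι → F) | p.1 ∈ vanishing F s ∧ p.2 ∈ vanishing F s ∧
      form ι F p.1 p.2 = 1} ≃ Σ x : {x : W // x ≠ 0}, {y : W // form ι F x.1 y = 1} :=
    { toFun := fun p => ⟨⟨⟨p.1.1, p.2.1⟩, fun h => by
        have h0 : p.1.1 = 0 := congrArg Subtype.val h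
        have := p.2.2.2
        simp [h0] at this⟩, ⟨⟨p.1.2, p.2.2.1⟩, p.2.2.2⟩⟩
      invFun := fun q => ⟨(q.1.1.1, q.2.1.1), q.1.1.2, q.2.1.2, q.2.2⟩
      left_inv := fun p => rfl
      right_inv := fun q => rfl }
  have hfib : ∀ x : {x : W // x ≠ 0},
      Nat.card {y : W // form ι F x.1 y = 1} * Nat.card F = Nat.card W := by
    intro x
    obtain ⟨y, hy, hxy⟩ := exists_form_eq_one x.1.2 (fun h => x.2 (Subtype.ext h))
    exact card_fiber_one_mul_card ((form ι F x.1).comp W.subtype) (x₀ := ⟨y, hy⟩) hxy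
  have := Fintype.ofFinite {x : W // x ≠ 0}
  have hne : Nat.card {x : W // x ≠ 0} = Nat.card W - 1 := by
    classical
    have := Fintype.ofFinite W
    rw [Nat.card_eq_fintype_card, Nat.card_eq_fintype_card, Fintype.card_subtype_compl]
    simp
  rw [← Nat.card_coe_set_eq, Nat.card_congr e, Nat.card_sigma, Finset.sum_mul,
    Finset.sum_congr rfl (fun x _ => hfib x), Finset.sum_const, Finset.card_univ,
    ← Nat.card_eq_fintype_card, hne, smul_eq_mul]

/-- Orbit and stabilizer for the action on hyperbolic pairs. Both sides carry a factor `q`, which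
avoids the division in the number `(q ^ (2r) - 1) * q ^ (2r - 1)` of hyperbolic pairs. -/
theorem card_planeStabilizer_mul_card [Finite F] {s : Finset ι} {a : ι} (ha : a ∉ s) :
    Nat.card (planeStabilizer F s) * Nat.card F = Nat.card (planeStabilizer F (insert a s))
      * ((Nat.card F ^ (2 * sᶜ.card) - 1) * Nat.card F ^ (2 * sᶜ.card)) := by
  have hle : planeStabilizer F (insert a s) ≤ planeStabilizer F s := fun g hg i hi =>
    hg i (Finset.mem_insert_of_mem hi)
  rw [← card_hyperbolicPairs_mul_card, ← orbit_planeStabilizer ha, ← MulAction.index_stabilizer,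
    stabilizer_planeStabilizer, ← mul_assoc,
    ← Nat.card_congr (Subgroup.subgroupOfEquivOfLe hle).toEquiv, Subgroup.card_mul_index]

/-- For `q ≡ ±3 mod 8` the order of `Sp₂ₘ(q)` has the same `2`-part as `8 ^ m * m!`. -/
theorem padicValNat_two_card [Finite F] (hq : Nat.card F % 8 = 3 ∨ Nat.card F % 8 = 5) :
    padicValNat 2 (Nat.card (symplecticGroup ι F))
      = 3 * Fintype.card ι + padicValNat 2 (Fintype.card ι).factorial := by
  set q := Nat.card F with hqdef
  have hodd : ¬ 2 ∣ q := by omega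
  -- lifting the exponent, with `q² - 1` exactly divisible by `8`
  have hval : ∀ r : ℕ, r ≠ 0 → padicValNat 2 (q ^ (2 * r) - 1) = 3 + padicValNat 2 r := by
    intro r hr
    have h1 := padicValNat.pow_two_sub_one (x := q) (n := 2 * r) (by omega) hodd (by omega)
      (even_two_mul r)
    have h2 : padicValNat 2 (q + 1) + padicValNat 2 (q - 1) = 3 := by
      have hv : ∀ c k, c % 2 = 1 → padicValNat 2 (2 ^ k * c) = k := fun c k hc => by
        rw [padicValNat.mul (by positivity) (by omega), padicValNat.prime_pow,
          padicValNat.eq_zero_of_not_dvd (by omega), add_zero]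
      rcases hq with hq | hq
      · rw [show q + 1 = 2 ^ 2 * ((q + 1) / 4) by omega, hv _ _ (by omega),
          show q - 1 = 2 ^ 1 * ((q - 1) / 2) by omega, hv _ _ (by omega)]
      · rw [show q + 1 = 2 ^ 1 * ((q + 1) / 2) by omega, hv _ _ (by omega),
          show q - 1 = 2 ^ 2 * ((q - 1) / 4) by omega, hv _ _ (by omega)]
    have h3 : padicValNat 2 (2 * r) = 1 + padicValNat 2 r := by
      rw [padicValNat.mul (by norm_num) hr, padicValNat.self (by norm_num)]
    omega
  suffices h : ∀ s : Finset ι, padicValNat 2 (Nat.card (planeStabilizer F sᶜ))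
      = 3 * s.card + padicValNat 2 s.card.factorial by
    have := h Finset.univ
    rwa [Finset.compl_univ, planeStabilizer_empty, Subgroup.card_top, Finset.card_univ] at this
  intro s
  induction s using Finset.induction_on with
  | empty => simp [planeStabilizer_univ]
  | insert a s ha ih =>
    set t := (insert a s)ᶜ with ht
    have hat : a ∉ t := by simp [ht]
    have hins : insert a t = sᶜ := by
      ext i
      by_cases h : i = a
      · simp [h, ha]
      · simp [ht, h]
    have hcard := card_planeStabilizer_mul_card (F := F) hat
    rw [hins, show tᶜ = insert a s by simp [ht], ← hqdef] at hcard
    have hr : (insert a s).card ≠ 0 := by simp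
    have h1 : q ^ (2 * (insert a s).card) - 1 ≠ 0 :=
      Nat.sub_ne_zero_of_lt (Nat.one_lt_pow (by omega) (by omega))
    have := congrArg (padicValNat 2) hcard
    have hq0 : padicValNat 2 q = 0 := padicValNat.eq_zero_of_not_dvd hodd
    rw [padicValNat.mul Nat.card_pos.ne' (by omega),
      padicValNat.mul Nat.card_pos.ne' (mul_ne_zero h1 (pow_ne_zero _ (by omega))),
      padicValNat.mul h1 (pow_ne_zero _ (by omega)), padicValNat.pow, hq0, hval _ hr, ih] at this
    rw [Finset.card_insert_of_notMem ha] at this ⊢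
    rw [Nat.factorial_succ, padicValNat.mul (by omega) (Nat.factorial_ne_zero _)]
    omega

/-! ### Transitivity on pairs of vectors -/

theorem exists_form_eq_one_of_ne_zero {x : ι ⊕ ι → F} (h0 : x ≠ 0) : ∃ y, form ι F x y = 1 := by
  obtain ⟨y, -, hy⟩ := exists_form_eq_one (s := ∅) (by simp [mem_vanishing]) h0
  exact ⟨y, hy⟩

theorem eq_of_forall_form_eq {x x' : ι ⊕ ι → F} (h : ∀ y, form ι F x y = form ι F x' y) :
    x = x' := by
  by_contra hne
  obtain ⟨y, hy⟩ := exists_form_eq_one_of_ne_zero (sub_ne_zero.2 hne)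
  simp [h] at hy

theorem form_ne_zero_comm {x y : ι ⊕ ι → F} : form ι F x y ≠ 0 ↔ form ι F y x ≠ 0 := by
  rw [form_swap x y, neg_ne_zero]

theorem exists_smul_pair_eq {e f e' f' : ι ⊕ ι → F} (h : form ι F e f = 1)
    (h' : form ι F e' f' = 1) : ∃ g : symplecticGroup ι F, g • e = e' ∧ g • f = f' := by
  obtain ⟨g, -, hg⟩ := exists_mem_transvectionSubgroup_smul_eq (W := ⊤) trivial trivial trivial
    trivial h h'
  exact ⟨g, hg⟩

theorem exists_form_eq_zero_and_ne_zero {u w : ι ⊕ ι → F} (hu : u ≠ 0) (hw : ∀ c : F, w ≠ c • u) :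
    ∃ z, form ι F u z = 0 ∧ form ι F w z ≠ 0 := by
  by_contra! hcon
  obtain ⟨y, hy⟩ := exists_form_eq_one_of_ne_zero hu
  refine hw (form ι F w y) (eq_of_forall_form_eq fun z => ?_)
  have := hcon (z - form ι F u z • y) (by simp [hy])
  rw [map_sub, map_smul, sub_eq_zero] at this
  rw [this]
  simp [mul_comm]

/-- The stabilizer of `u` is transitive on the vectors orthogonal to `u` and independent of it. -/
theorem exists_smul_eq_of_form_eq_zero {u w x : ι ⊕ ι → F} (hu : u ≠ 0)
    (hw : form ι F u w = 0) (hx : form ι F u x = 0) (hwu : ∀ c : F, w ≠ c • u)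
    (hxu : ∀ c : F, x ≠ c • u) : ∃ g : symplecticGroup ι F, g • u = u ∧ g • w = x := by
  have step : ∀ y z, form ι F u y = 0 → form ι F u z = 0 → form ι F y z ≠ 0 →
      ∃ g : symplecticGroup ι F, g • u = u ∧ g • y = z := fun y z hy hz hyz =>
    ⟨_, transvection_smul_of_form_eq_zero _ (by
      rw [form_swap u]
      simp [hy, hz]), transvection_sub_smul hyz⟩
  obtain ⟨z, hz, hwz, hzx⟩ : ∃ z, form ι F u z = 0 ∧ form ι F w z ≠ 0 ∧ form ι F x z ≠ 0 := by
    obtain ⟨z₁, h1, hw1⟩ := exists_form_eq_zero_and_ne_zero hu hwu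
    obtain ⟨z₂, h2, hx2⟩ := exists_form_eq_zero_and_ne_zero hu hxu
    by_cases hw2 : form ι F w z₂ = 0
    · by_cases hx1 : form ι F x z₁ = 0
      · exact ⟨z₁ + z₂, by simp [h1, h2], by simpa [hw2] using hw1, by simpa [hx1] using hx2⟩
      · exact ⟨z₁, h1, hw1, hx1⟩
    · exact ⟨z₂, h2, hw2, hx2⟩
  obtain ⟨g, hgu, hg⟩ := step w z hw hz hwz
  obtain ⟨k, hku, hk⟩ := step z x hz hx (form_ne_zero_comm.1 hzx)
  exact ⟨k * g, by rw [mul_smul, hgu, hku], by rw [mul_smul, hg, hk]⟩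

/-! ### Scalar matrices and the centre -/

theorem mem_center_of_coe_eq_smul_one {g : symplecticGroup ι F} {c : F}
    (h : (g : Matrix (ι ⊕ ι) (ι ⊕ ι) F) = c • 1) : g ∈ Subgroup.center (symplecticGroup ι F) := by
  rw [Subgroup.mem_center_iff]
  intro k
  apply Subtype.ext
  simp [h]

theorem coe_eq_smul_one_of_forall {g : symplecticGroup ι F}
    (h : ∀ v : ι ⊕ ι → F, ∃ c : F, g • v = c • v) :
    ∃ c : F, (g : Matrix (ι ⊕ ι) (ι ⊕ ι) F) = c • 1 := by
  obtain ⟨c, hc⟩ := LinearMap.exists_eq_smul_id_of_forall_notLinearIndependent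
    (f := Matrix.toLin' (g : Matrix (ι ⊕ ι) (ι ⊕ ι) F)) fun v hv => by
      obtain ⟨c, hc⟩ := h v
      have := LinearIndependent.pair_iff.1 hv c (-1) (by
        rw [Matrix.toLin'_apply, show (g : Matrix (ι ⊕ ι) (ι ⊕ ι) F) *ᵥ v = c • v from hc]
        simp)
      simp at this
  refine ⟨c, Matrix.toLin'.injective ?_⟩
  rw [hc, map_smul, Matrix.toLin'_one]
  rfl

/-- A central element commutes with the transvection along `v`, hence preserves the line spanned by
`v`, which is the direction of that transvection. -/
theorem exists_smul_eq_of_mem_center {g : symplecticGroup ι F}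
    (hg : g ∈ Subgroup.center (symplecticGroup ι F)) (v : ι ⊕ ι → F) : ∃ c : F, g • v = c • v := by
  rcases eq_or_ne v 0 with rfl | hv
  · exact ⟨0, by simp⟩
  obtain ⟨y, hy⟩ := exists_form_eq_one_of_ne_zero hv
  have h1 := conj_transvection g v 1
  rw [← Subgroup.mem_center_iff.1 hg, mul_inv_cancel_right] at h1
  have h2 := congrArg (· • y) h1
  simp only [transvection_smul, hy, one_mul, one_smul, add_right_inj] at h2
  have h3 : form ι F (g • v) y ≠ 0 := fun h => hv (by rw [h2, h, zero_smul])
  exact ⟨(form ι F (g • v) y)⁻¹, by rw [eq_inv_smul_iff₀ h3, ← h2]⟩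

theorem coe_eq_smul_one_of_mem_center {g : symplecticGroup ι F}
    (hg : g ∈ Subgroup.center (symplecticGroup ι F)) :
    ∃ c : F, (g : Matrix (ι ⊕ ι) (ι ⊕ ι) F) = c • 1 :=
  coe_eq_smul_one_of_forall (exists_smul_eq_of_mem_center hg)

/-! ### Orbits of normal subgroups on lines -/

/-- Some element of `N` maps the line through `u` to the line through `w`. -/
def LineRel (N : Subgroup (symplecticGroup ι F)) (u w : ι ⊕ ι → F) : Prop :=
  ∃ n ∈ N, ∃ c : F, c ≠ 0 ∧ n • u = c • w

namespace LineRel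

variable {N : Subgroup (symplecticGroup ι F)} {u w x : ι ⊕ ι → F}

theorem symm (h : LineRel N u w) : LineRel N w u := by
  obtain ⟨n, hn, c, hc, h⟩ := h
  refine ⟨n⁻¹, inv_mem hn, c⁻¹, inv_ne_zero hc, ?_⟩
  rw [inv_smul_eq_iff, smul_comm, h, inv_smul_smul₀ hc]

theorem trans (h : LineRel N u w) (h' : LineRel N w x) : LineRel N u x := by
  obtain ⟨n, hn, c, hc, h⟩ := h
  obtain ⟨k, hk, d, hd, h'⟩ := h'
  refine ⟨k * n, mul_mem hk hn, c * d, mul_ne_zero hc hd, ?_⟩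
  rw [mul_smul, h, smul_comm, h', mul_smul]

theorem smul_right (h : LineRel N u w) {c : F} (hc : c ≠ 0) : LineRel N u (c • w) := by
  obtain ⟨n, hn, d, hd, h⟩ := h
  exact ⟨n, hn, d * c⁻¹, mul_ne_zero hd (inv_ne_zero hc), by rw [h, mul_smul, inv_smul_smul₀ hc]⟩

theorem smul [N.Normal] (h : LineRel N u w) (g : symplecticGroup ι F) :
    LineRel N (g • u) (g • w) := by
  obtain ⟨n, hn, c, hc, h⟩ := h
  refine ⟨g * n * g⁻¹, Subgroup.Normal.conj_mem ‹_› n hn g, c, hc, ?_⟩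
  rw [mul_smul, mul_smul, inv_smul_smul, h, smul_comm]

theorem of_form_ne_zero_of_form_ne_zero [N.Normal] (h : LineRel N u w) (huw : form ι F u w ≠ 0)
    (hux : form ι F u x ≠ 0) : LineRel N u x := by
  obtain ⟨g, hgu, hgw⟩ := exists_smul_pair_eq (e := u) (e' := u) (f := (form ι F u w)⁻¹ • w)
    (f' := (form ι F u x)⁻¹ • x) (by simp [huw]) (by simp [hux])
  have := ((h.smul_right (inv_ne_zero huw)).smul g).smul_right hux
  rwa [hgu, hgw, smul_inv_smul₀ hux] at this

/-- When `x` is orthogonal to `u`, connect them through a vector orthogonal to neither. -/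
theorem of_form_ne_zero [N.Normal] (h : LineRel N u w) (huw : form ι F u w ≠ 0) (hx : x ≠ 0) :
    LineRel N u x := by
  by_cases hux : form ι F u x = 0
  · have hu : u ≠ 0 := by
      rintro rfl
      simp at huw
    obtain ⟨y₁, h1⟩ := exists_form_eq_one_of_ne_zero hu
    obtain ⟨y₂, h2⟩ := exists_form_eq_one_of_ne_zero hx
    obtain ⟨z, hz, hxz⟩ : ∃ z, form ι F u z ≠ 0 ∧ form ι F x z ≠ 0 := by
      by_cases hu2 : form ι F u y₂ = 0
      · by_cases hx1 : form ι F x y₁ = 0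
        · exact ⟨y₁ + y₂, by simp [h1, hu2], by simp [h2, hx1]⟩
        · exact ⟨y₁, by simp [h1], hx1⟩
      · exact ⟨y₂, hu2, by simp [h2]⟩
    have huz := h.of_form_ne_zero_of_form_ne_zero huw hz
    exact huz.trans (huz.symm.of_form_ne_zero_of_form_ne_zero (form_ne_zero_comm.1 hz)
      (form_ne_zero_comm.1 hxz))
  · exact h.of_form_ne_zero_of_form_ne_zero huw hux

theorem of_form_eq_zero [N.Normal] (h : LineRel N u w) (hu : u ≠ 0) (huw : form ι F u w = 0)
    (hwu : ∀ c : F, w ≠ c • u) (hux : form ι F u x = 0) (hxu : ∀ c : F, x ≠ c • u) :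
    LineRel N u x := by
  obtain ⟨g, hgu, hgw⟩ := exists_smul_eq_of_form_eq_zero hu huw hux hwu hxu
  simpa [hgu, hgw] using h.smul g

/-- Primitivity of the symplectic group on lines: the orbits of a normal subgroup on the lines are
blocks, so one nontrivial orbit forces transitivity. -/
theorem of_ne_smul [Nontrivial ι] [N.Normal] (h : LineRel N u w) (hu : u ≠ 0)
    (hwu : ∀ c : F, w ≠ c • u) (hx : x ≠ 0) : LineRel N u x := by
  by_cases huw : form ι F u w = 0
  · -- pass through a vector `z` orthogonal both to `u` and to some `y` not orthogonal to `u`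
    obtain ⟨y, hy⟩ := exists_form_eq_one_of_ne_zero hu
    obtain ⟨z, hz, huz, hyz⟩ : ∃ z, z ≠ 0 ∧ form ι F u z = 0 ∧ form ι F y z = 0 := by
      obtain ⟨a, b, hab⟩ := exists_pair_ne ι
      obtain ⟨g, rfl, rfl⟩ := exists_smul_pair_eq (e := Pi.single (.inr a) 1)
        (f := Pi.single (.inl a) 1) (by simp [form_single_inr]) hy
      refine ⟨g • Pi.single (.inr b) 1, ?_, ?_, ?_⟩
      · rw [Ne, smul_eq_zero_iff_eq]
        simp
      · rw [form_smul_smul, form_single_inr]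
        simp
      · rw [form_smul_smul, form_single_inl]
        simp [hab]
    have hzu : ∀ c : F, z ≠ c • u := by
      rintro c rfl
      rw [map_smul, smul_eq_mul, form_swap u, hy] at hyz
      have : c = 0 := by simpa using hyz
      simp [this] at hz
    have hRuz := h.of_form_eq_zero hu huw hwu huz hzu
    have hRzy : LineRel N z y := by
      refine hRuz.symm.of_form_eq_zero hz (by rw [form_swap u, huz, neg_zero]) ?_
        (by rw [form_swap y, hyz, neg_zero]) ?_
      · rintro c rfl
        simp [form_swap y z, hyz] at hy
      · rintro c rfl
        simp [huz] at hy
    exact (hRuz.trans hRzy).of_form_ne_zero (by simp [hy]) hx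
  · exact h.of_form_ne_zero huw hx

end LineRel

/-! ### Simplicity of the projective symplectic group -/

theorem transvection_mul_transvection (v : ι ⊕ ι → F) (a b : F) :
    transvection v a * transvection v b = transvection v (a + b) := by
  refine ext_smul fun x => ?_
  rw [mul_smul, transvection_smul v b, transvection_smul, transvection_smul]
  simp only [map_add, map_smul, form_self, smul_zero, add_zero]
  module

/-- The root subgroup of transvections along `v`. -/
def transvectionHom (v : ι ⊕ ι → F) : Multiplicative F →* symplecticGroup ι F where
  toFun a := transvection v a.toAdd
  map_one' := ext_smul fun x => by simp [transvection_smul]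
  map_mul' a b := (transvection_mul_transvection v _ _).symm

theorem transvection_smul_left (v : ι ⊕ ι → F) (a c : F) :
    transvection (c • v) a = transvection v (c ^ 2 * a) := by
  refine ext_smul fun x => ?_
  rw [transvection_smul, transvection_smul]
  simp only [map_smul, LinearMap.smul_apply, smul_eq_mul]
  module

/-- If `N` is transitive on lines, every transvection is conjugate under `N` to one along `u`. -/
theorem sup_range_transvectionHom_eq_top {N : Subgroup (symplecticGroup ι F)} [N.Normal]
    {u : ι ⊕ ι → F} (h : ∀ x ≠ 0, LineRel N u x) : N ⊔ (transvectionHom u).range = ⊤ := by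
  rw [← top_le_iff, ← transvectionSubgroup_top, transvectionSubgroup, Subgroup.closure_le]
  rintro _ ⟨v, -, a, rfl⟩
  rcases eq_or_ne v 0 with rfl | hv
  · have : transvection (0 : ι ⊕ ι → F) a = 1 := ext_smul fun x => by simp [transvection_smul]
    rw [this]
    exact one_mem _
  obtain ⟨n, hn, c, hc, hnc⟩ := h v hv
  have hv' : v = n • (c⁻¹ • u) := by rw [smul_comm, hnc, inv_smul_smul₀ hc]
  rw [hv', ← conj_transvection, transvection_smul_left]
  exact mul_mem (mul_mem (Subgroup.mem_sup_left hn)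
    (Subgroup.mem_sup_right ⟨Multiplicative.ofAdd _, rfl⟩))
    (inv_mem (Subgroup.mem_sup_left hn))

/-- In characteristic different from two every transvection is a commutator: for `w` orthogonal to
`u` and `g` fixing `u` and mapping `w` to `u + w`, it is the commutator of `g` with the isometry
attached to the symmetric tensor `(a / 2) * ((u + w) ⊗ (u + w) - w ⊗ w)`, as conjugation by `g` adds
`a * (u ⊗ u)` to this tensor. -/
theorem transvection_mem_commutator [Nontrivial ι] (h2 : (2 : F) ≠ 0) (u : ι ⊕ ι → F) (a : F) :
    transvection u a ∈ commutator (symplecticGroup ι F) := by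
  rcases eq_or_ne u 0 with rfl | hu
  · have : transvection (0 : ι ⊕ ι → F) a = 1 := ext_smul fun x => by simp [transvection_smul]
    rw [this]
    exact one_mem _
  obtain ⟨y, hy⟩ := exists_form_eq_one_of_ne_zero hu
  obtain ⟨w, huw, hwu⟩ : ∃ w, form ι F u w = 0 ∧ ∀ c : F, w ≠ c • u := by
    obtain ⟨i, j, hij⟩ := exists_pair_ne ι
    obtain ⟨g, rfl, rfl⟩ := exists_smul_pair_eq (e := Pi.single (.inr i) 1)
      (f := Pi.single (.inl i) 1) (by simp [form_single_inr]) hy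
    refine ⟨g • Pi.single (.inr j) 1, ?_, fun c hc => ?_⟩
    · rw [form_smul_smul, form_single_inr]
      simp
    · rw [smul_comm, smul_left_cancel_iff] at hc
      have := congrFun hc (.inr j)
      simp [hij.symm] at this
  have hwu' : ∀ c : F, u + w ≠ c • u := fun c hc => hwu (c - 1) (by
    rw [sub_smul, one_smul, ← hc, add_sub_cancel_left])
  obtain ⟨g, hgu, hgw⟩ := exists_smul_eq_of_form_eq_zero hu huw
    (by simp [huw] : form ι F u (u + w) = 0) hwu hwu'
  have hwu0 : form ι F w u = 0 := by rw [form_swap u, huw, neg_zero]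
  have key : ⁅g, transvection (u + w) (a / 2) * transvection w (-(a / 2))⁆ = transvection u a := by
    rw [commutatorElement_def, mul_inv_eq_iff_eq_mul]
    have : g * (transvection (u + w) (a / 2) * transvection w (-(a / 2))) * g⁻¹
        = g * transvection (u + w) (a / 2) * g⁻¹ * (g * transvection w (-(a / 2)) * g⁻¹) := by
      group
    rw [this, conj_transvection, conj_transvection, smul_add, hgu, hgw]
    refine ext_smul fun x => ?_
    simp only [mul_smul, transvection_smul, map_add, map_smul, LinearMap.add_apply, form_self, huw,
      hwu0, smul_eq_mul, mul_zero, add_zero]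
    match_scalars <;> field_simp <;> ring
  rw [← key]
  exact Subgroup.commutator_mem_commutator (Subgroup.mem_top _) (Subgroup.mem_top _)

theorem commutator_eq_top [Nontrivial ι] (h2 : (2 : F) ≠ 0) :
    commutator (symplecticGroup ι F) = ⊤ := by
  rw [← top_le_iff, ← transvectionSubgroup_top, transvectionSubgroup, Subgroup.closure_le]
  rintro _ ⟨v, -, a, rfl⟩
  exact transvection_mem_commutator h2 v a

theorem le_center_or_eq_top [Nontrivial ι] (h2 : (2 : F) ≠ 0) (N : Subgroup (symplecticGroup ι F))
    [N.Normal] : N ≤ Subgroup.center (symplecticGroup ι F) ∨ N = ⊤ := by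
  refine or_iff_not_imp_left.2 fun hN => ?_
  obtain ⟨n, hn, hnc⟩ := SetLike.not_le_iff_exists.1 hN
  obtain ⟨u, hu⟩ : ∃ u : ι ⊕ ι → F, ∀ c : F, n • u ≠ c • u := by
    by_contra! h
    obtain ⟨c, hc⟩ := coe_eq_smul_one_of_forall h
    exact hnc (mem_center_of_coe_eq_smul_one hc)
  have hu0 : u ≠ 0 := by
    rintro rfl
    exact hu 0 (by simp)
  have hrel : LineRel N u (n • u) := ⟨n, hn, 1, one_ne_zero, (one_smul _ _).symm⟩
  have hsup := sup_range_transvectionHom_eq_top fun x hx => hrel.of_ne_smul hu0 hu hx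
  have hcomm : IsMulCommutative (transvectionHom u).range := inferInstance
  rw [← top_le_iff, ← commutator_eq_top h2]
  exact Subgroup.Normal.commutator_le_of_self_sup_commutative_eq_top hsup hcomm

theorem center_ne_top [Nonempty ι] : Subgroup.center (symplecticGroup ι F) ≠ ⊤ := by
  intro h
  obtain ⟨i⟩ := ‹Nonempty ι›
  set u : ι ⊕ ι → F := Pi.single (.inr i) 1 with hu
  have hy : form ι F u (Pi.single (.inl i) 1) = 1 := by simp [hu, form_single_inr]
  obtain ⟨c, hc⟩ := exists_smul_eq_of_mem_center (h ▸ Subgroup.mem_top (transvection u 1))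
    (Pi.single (.inl i) 1)
  rw [transvection_smul, hy] at hc
  have := congrFun hc (.inr i)
  simp [hu] at this

/-- Over a field of characteristic different from two the projective symplectic group of degree at
least four is simple. -/
theorem isSimpleGroup_quotient_center [Nontrivial ι] (h2 : (2 : F) ≠ 0) :
    IsSimpleGroup (symplecticGroup ι F ⧸ Subgroup.center (symplecticGroup ι F)) := by
  have : Nontrivial (symplecticGroup ι F ⧸ Subgroup.center (symplecticGroup ι F)) :=
    QuotientGroup.nontrivial_iff.2 center_ne_top
  refine ⟨fun H hH => ?_⟩
  set π := QuotientGroup.mk' (Subgroup.center (symplecticGroup ι F)) with hπ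
  have hmap := Subgroup.map_comap_eq_self_of_surjective (QuotientGroup.mk'_surjective
    (Subgroup.center (symplecticGroup ι F))) H
  rcases le_center_or_eq_top h2 (H.comap π) with h | h
  · left
    rw [← hmap, Subgroup.map_eq_bot_iff, QuotientGroup.ker_mk']
    exact h
  · right
    rw [← hmap, h, Subgroup.map_top_of_surjective _ (QuotientGroup.mk'_surjective _)]

/-! ### A wreath product of odd index -/

/-- The group `SL₂(F) ^ ι` acting on the orthogonal sum of hyperbolic planes indexed by `ι`. -/
def blockHom : (ι → SpecialLinearGroup (Fin 2) F) →* symplecticGroup ι F where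
  toFun f := ⟨fromBlocks (diagonal fun i => f i 0 0) (diagonal fun i => f i 0 1)
    (diagonal fun i => f i 1 0) (diagonal fun i => f i 1 1), by
      have hdet : ∀ i, f i 0 0 * f i 1 1 - f i 0 1 * f i 1 0 = 1 := fun i => by
        rw [← Matrix.det_fin_two]
        exact (f i).2
      have hJ : J ι F = fromBlocks (diagonal fun _ => 0) (diagonal fun _ => -1)
          (diagonal fun _ => 1) (diagonal fun _ => 0) := by
        simp [J, ← diagonal_neg]
      rw [mem_iff, hJ, fromBlocks_transpose, fromBlocks_multiply, fromBlocks_multiply]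
      simp only [diagonal_transpose, diagonal_mul_diagonal, diagonal_add]
      rw [fromBlocks_inj]
      refine ⟨congrArg diagonal (funext fun i => ?_), congrArg diagonal (funext fun i => ?_),
        congrArg diagonal (funext fun i => ?_), congrArg diagonal (funext fun i => ?_)⟩
      · ring
      · linear_combination -hdet i
      · linear_combination hdet i
      · ring⟩
  map_one' := Subtype.ext (by simp)
  map_mul' f g := Subtype.ext (by
    simp only [Submonoid.coe_mul, fromBlocks_multiply, diagonal_mul_diagonal, diagonal_add]
    simp [Matrix.mul_apply, Fin.sum_univ_two])

/-- The symmetric group permuting the hyperbolic planes indexed by `ι`. -/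
def permHom : Equiv.Perm ι →* symplecticGroup ι F where
  toFun s := ⟨fromBlocks (permMatrixHom s) 0 0 (permMatrixHom s), by
    have h : permMatrixHom s * (permMatrixHom (R := F) s)ᵀ = 1 := by
      rw [permMatrixHom_apply, transpose_permMatrix, ← permMatrix_mul]
      simp
    rw [mem_iff, J, fromBlocks_transpose, fromBlocks_multiply, fromBlocks_multiply]
    simp [h, -permMatrixHom_apply]⟩
  map_one' := Subtype.ext (by simp)
  map_mul' s t := Subtype.ext (by
    simp [fromBlocks_multiply, -permMatrixHom_apply])

theorem permMatrixHom_apply_apply (s : Equiv.Perm ι) (i k : ι) :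
    permMatrixHom (R := F) s i k = if s⁻¹ i = k then 1 else 0 := by
  change (Equiv.toPEquiv s⁻¹).toMatrix i k = _
  rw [PEquiv.toMatrix_apply]
  simp [Equiv.toPEquiv_apply, eq_comm]

theorem permMatrixHom_mul_diagonal (s : Equiv.Perm ι) (d : ι → F) :
    permMatrixHom s * diagonal d = diagonal (fun i => d (s⁻¹ i)) * permMatrixHom s := by
  ext i k
  rw [Matrix.mul_diagonal, Matrix.diagonal_mul, permMatrixHom_apply_apply]
  by_cases h : s⁻¹ i = k
  · rw [if_pos h, h, one_mul, mul_one]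
  · rw [if_neg h, zero_mul, mul_zero]

/-- The imprimitive action of the wreath product of `T ≤ SL₂(F)` on the orthogonal sum of hyperbolic
planes indexed by `ι`. -/
def wreathHom {T : Type*} [Group T] (j : T →* SpecialLinearGroup (Fin 2) F) :
    PermWreath T ι →* symplecticGroup ι F :=
  SemidirectProduct.lift (blockHom.comp (j.compLeft ι)) permHom fun s => by
    refine MonoidHom.ext fun f => ?_
    simp only [MonoidHom.comp_apply, MulEquiv.coe_toMonoidHom, MulAut.conj_apply]
    rw [eq_mul_inv_iff_mul_eq]
    apply Subtype.ext
    simp only [Submonoid.coe_mul, blockHom, permHom, MonoidHom.coe_mk, OneHom.coe_mk,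
      fromBlocks_multiply, Matrix.mul_zero, Matrix.zero_mul, add_zero, zero_add,
      permMatrixHom_mul_diagonal]
    rfl

theorem coe_wreathHom {T : Type*} [Group T] (j : T →* SpecialLinearGroup (Fin 2) F)
    (w : PermWreath T ι) : (wreathHom j w : Matrix (ι ⊕ ι) (ι ⊕ ι) F) =
      fromBlocks (diagonal (fun i => j (w.left i) 0 0) * permMatrixHom w.right)
        (diagonal (fun i => j (w.left i) 0 1) * permMatrixHom w.right)
        (diagonal (fun i => j (w.left i) 1 0) * permMatrixHom w.right)
        (diagonal (fun i => j (w.left i) 1 1) * permMatrixHom w.right) := by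
  change (blockHom _ * permHom _ : symplecticGroup ι F).1 = _
  simp only [Submonoid.coe_mul, blockHom, permHom, MonoidHom.coe_mk, OneHom.coe_mk,
      fromBlocks_multiply, Matrix.mul_zero, add_zero, zero_add]
  rfl

/-- A nontrivial permutation part would make the first row of some `2 × 2` block vanish. -/
theorem eq_smul_one_of_coe_wreathHom_eq {T : Type*} [Group T]
    {j : T →* SpecialLinearGroup (Fin 2) F} {w : PermWreath T ι} {c : F}
    (h : (wreathHom j w : Matrix (ι ⊕ ι) (ι ⊕ ι) F) = c • 1) :
    w.right = 1 ∧ ∀ i, (j (w.left i) : Matrix (Fin 2) (Fin 2) F) = c • 1 := by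
  rw [coe_wreathHom, ← fromBlocks_one, fromBlocks_smul, fromBlocks_inj] at h
  obtain ⟨h00, h01, h10, h11⟩ := h
  have hr : w.right = 1 := by
    refine inv_injective (Equiv.ext fun i => ?_)
    by_contra hne
    have hne : i ≠ w.right⁻¹ i := fun h' => hne (by simpa using h'.symm)
    have e0 := congrFun₂ h00 i (w.right⁻¹ i)
    have e1 := congrFun₂ h01 i (w.right⁻¹ i)
    rw [Matrix.diagonal_mul, permMatrixHom_apply_apply, if_pos rfl, mul_one] at e0 e1
    rw [Matrix.smul_apply, Matrix.one_apply_ne hne, smul_zero] at e0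
    rw [Matrix.smul_apply, Matrix.zero_apply, smul_zero] at e1
    have hdet := (j (w.left i)).2
    rw [Matrix.det_fin_two] at hdet
    simp [e0, e1] at hdet
  refine ⟨hr, fun i => ?_⟩
  have e0 := congrFun₂ h00 i i
  have e1 := congrFun₂ h01 i i
  have e2 := congrFun₂ h10 i i
  have e3 := congrFun₂ h11 i i
  rw [Matrix.diagonal_mul, hr, map_one] at e0 e1 e2 e3
  simp only [Matrix.one_apply_eq, mul_one, Matrix.smul_apply, Matrix.zero_apply, smul_zero]
    at e0 e1 e2 e3
  ext a b
  fin_cases a <;> fin_cases b <;> simp [e0, e1, e2, e3]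

theorem wreathHom_injective {T : Type*} [Group T] {j : T →* SpecialLinearGroup (Fin 2) F}
    (hj : Function.Injective j) : Function.Injective (wreathHom (ι := ι) j) := by
  rw [injective_iff_map_eq_one]
  intro w hw
  obtain ⟨h1, h2⟩ := eq_smul_one_of_coe_wreathHom_eq (j := j) (w := w) (c := 1) (by
    rw [hw]
    simp)
  refine SemidirectProduct.ext (funext fun i => hj ?_) h1
  rw [SemidirectProduct.one_left, Pi.one_apply, map_one]
  exact Subtype.ext (by simpa using h2 i)

/-- An element of the wreath product acting as a scalar acts as `±1`, so its base coordinates are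
involutions, which `φ` kills. -/
theorem ker_mk'_comp_wreathHom_le {T C : Type*} [Group T] [CommGroup C]
    (j : T →* SpecialLinearGroup (Fin 2) F) (hj : Function.Injective j) (φ : T →* C)
    (hC : ∀ c : C, c ^ 3 = 1) :
    ((QuotientGroup.mk' (Subgroup.center (symplecticGroup ι F))).comp (wreathHom j)).ker
      ≤ PermWreath.kerWreath φ := by
  intro w hw i
  rw [← MonoidHom.comap_ker, QuotientGroup.ker_mk', Subgroup.mem_comap] at hw
  obtain ⟨c, hc⟩ := coe_eq_smul_one_of_mem_center hw
  have h := (eq_smul_one_of_coe_wreathHom_eq hc).2 i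
  have hc2 : c ^ 2 = 1 := by
    have := (j (w.left i)).2
    rw [h] at this
    simpa using this
  have h2 : w.left i ^ 2 = 1 := hj <| by
    have : (j (w.left i) : Matrix (Fin 2) (Fin 2) F) * j (w.left i) = 1 := by
      rw [h, smul_mul_smul, ← sq, hc2]
      simp
    rw [map_pow, map_one, sq]
    exact Subtype.ext this
  calc φ (w.left i) = φ (w.left i) ^ 3 * (φ (w.left i ^ 2))⁻¹ := by
        rw [map_pow]
        group
    _ = 1 := by rw [hC, h2, map_one, inv_one, mul_one]

end SymplecticGroup

/-! ### The quaternion group in `SL₂(F)` and its automorphism of order three -/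

/-- The powers of an element `x` with `x ^ n = 1`, indexed by `ZMod n`. -/
def zmodPowersHom {G : Type*} [Group G] (n : ℕ) (x : G) (hx : x ^ n = 1) :
    Multiplicative (ZMod n) →* G :=
  AddMonoidHom.toMultiplicativeLeft
    (ZMod.lift n ⟨(zmultiplesHom (Additive G)) (Additive.ofMul x), by
      rw [zmultiplesHom_apply, natCast_zsmul, ← ofMul_pow, hx, ofMul_one]⟩)

theorem zmodPowersHom_intCast {G : Type*} [Group G] {n : ℕ} {x : G} (hx : x ^ n = 1) (k : ℤ) :
    zmodPowersHom n x hx (Multiplicative.ofAdd (k : ZMod n)) = x ^ k := by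
  change Additive.toMul (ZMod.lift n _ (k : ZMod n)) = x ^ k
  rw [ZMod.lift_coe]
  simp

/-- Elements `x`, `y` with `x ^ 4 = 1`, `y ^ 2 = x ^ 2` and `x * y = y * x⁻¹` define a homomorphism
from the quaternion group. -/
def QuaternionGroup.liftTwo {G : Type*} [Group G] (x y : G) (hx : x ^ 4 = 1) (hy : y * y = x ^ 2)
    (hxy : x * y = y * x⁻¹) : QuaternionGroup 2 →* G :=
  let p : Multiplicative (ZMod (2 * 2)) →* G := zmodPowersHom (2 * 2) x hx
  have hp : ∀ k : ℤ, p (Multiplicative.ofAdd (k : ZMod (2 * 2))) = x ^ k :=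
    zmodPowersHom_intCast hx
  have hpy : ∀ i, p (Multiplicative.ofAdd i) * y = y * p (Multiplicative.ofAdd (-i)) := fun i => by
    obtain ⟨k, rfl⟩ := ZMod.intCast_surjective i
    rw [← Int.cast_neg, hp, hp, zpow_neg, ← inv_zpow]
    have h : SemiconjBy y x⁻¹ x := hxy.symm
    exact (h.zpow_right k).symm
  { toFun := fun
      | .a i => p (Multiplicative.ofAdd i)
      | .xa i => y * p (Multiplicative.ofAdd i)
    map_one' := map_one p
    map_mul' := by
      have h2 : p (Multiplicative.ofAdd (2 : ZMod (2 * 2))) = y * y := by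
        rw [hy]
        exact_mod_cast hp 2
      rintro (i | i) (j | j)
      · rw [QuaternionGroup.a_mul_a]
        simp only [ofAdd_add, map_mul]
      · rw [QuaternionGroup.a_mul_xa]
        simp only
        rw [← mul_assoc, hpy, mul_assoc, ← map_mul, ← ofAdd_add, neg_add_eq_sub]
      · rw [QuaternionGroup.xa_mul_a]
        simp only [ofAdd_add, map_mul, mul_assoc]
      · rw [QuaternionGroup.xa_mul_xa]
        simp only
        rw [mul_assoc, ← mul_assoc _ y, hpy, mul_assoc, ← map_mul, ← ofAdd_add, ← mul_assoc,
          show ((2 : ℕ) : ZMod (2 * 2)) + j - i = 2 + (-i + j) by push_cast; ring, ofAdd_add,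
          map_mul, h2] }

theorem QuaternionGroup.liftTwo_a {G : Type*} [Group G] {x y : G} (hx : x ^ 4 = 1)
    (hy : y * y = x ^ 2) (hxy : x * y = y * x⁻¹) (k : ℤ) :
    liftTwo x y hx hy hxy (.a k) = x ^ k :=
  zmodPowersHom_intCast hx k

theorem QuaternionGroup.liftTwo_xa {G : Type*} [Group G] {x y : G} (hx : x ^ 4 = 1)
    (hy : y * y = x ^ 2) (hxy : x * y = y * x⁻¹) (k : ℤ) :
    liftTwo x y hx hy hxy (.xa k) = y * x ^ k :=
  congrArg (y * ·) (zmodPowersHom_intCast hx k)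

theorem QuaternionGroup.liftTwo_injective {G : Type*} [Group G] {x y : G} (hx : x ^ 4 = 1)
    (hy : y * y = x ^ 2) (hxy : x * y = y * x⁻¹) (hx2 : x ^ 2 ≠ 1) :
    Function.Injective (liftTwo x y hx hy hxy) := by
  have hord : orderOf x = 2 ^ (1 + 1) :=
    orderOf_eq_prime_pow (by simpa using hx2) (by simpa using hx)
  rw [injective_iff_map_eq_one]
  rintro (i | i) h
  · obtain ⟨k, rfl⟩ := ZMod.intCast_surjective i
    rw [liftTwo_a, ← orderOf_dvd_iff_zpow_eq_one, hord] at h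
    rw [(ZMod.intCast_zmod_eq_zero_iff_dvd k _).2 (by simpa using h), a_zero]
  · -- otherwise `y` is a power of `x`, hence commutes with `x`
    obtain ⟨k, rfl⟩ := ZMod.intCast_surjective i
    rw [liftTwo_xa, mul_eq_one_iff_eq_inv] at h
    refine absurd ?_ hx2
    have hc : x * y = y * x := by
      rw [h, ← zpow_neg]
      exact (Commute.refl x).zpow_right _
    rw [hc] at hxy
    rw [sq, mul_eq_one_iff_eq_inv]
    exact mul_left_cancel hxy

/-- An element `ω` of order three permuting `x`, `y`, `x * y` cyclically normalizes the quaternion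
group they generate, and together they form an extension of `C₃` by the quaternion group. -/
theorem exists_hom_card_ker_eq_eight.{u} {G : Type u} [Group G] {x y w : G} (hx : x ^ 4 = 1)
    (hy : y * y = x ^ 2) (hxy : x * y = y * x⁻¹) (hx2 : x ^ 2 ≠ 1) (hw : w ^ 3 = 1)
    (hwx : w * x * w⁻¹ = y) (hwy : w * y * w⁻¹ = x * y) :
    ∃ (T C : Type u) (_ : Group T) (_ : CommGroup C) (j : T →* G) (φ : T →* C),
      Function.Injective j ∧ Nat.card φ.ker = 8 ∧ (∀ c : C, c ^ 3 = 1) ∧ ∃ t, φ t ≠ 1 := by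
  set f := QuaternionGroup.liftTwo x y hx hy hxy with hf
  set Q := f.range with hQ
  have hQcard : Nat.card Q = 8 := by
    have hf := QuaternionGroup.liftTwo_injective hx hy hxy hx2
    rw [Nat.card_congr (f.ofInjective hf).toEquiv.symm, Nat.card_eq_fintype_card,
      QuaternionGroup.card]
  have hxQ : x ∈ Q := ⟨.a (1 : ℤ), by rw [hf, QuaternionGroup.liftTwo_a, zpow_one]⟩
  have hyQ : y ∈ Q := ⟨.xa (0 : ℤ), by rw [hf, QuaternionGroup.liftTwo_xa, zpow_zero, mul_one]⟩
  have hconj : ∀ h ∈ Q, w * h * w⁻¹ ∈ Q := by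
    have hpow : ∀ k : ℤ, w * x ^ k * w⁻¹ = y ^ k := fun k => by rw [← conj_zpow, hwx]
    rintro _ ⟨i | i, rfl⟩
    · obtain ⟨k, rfl⟩ := ZMod.intCast_surjective i
      rw [hf, QuaternionGroup.liftTwo_a, hpow]
      exact zpow_mem hyQ k
    · obtain ⟨k, rfl⟩ := ZMod.intCast_surjective i
      rw [hf, QuaternionGroup.liftTwo_xa, ← conj_mul, hwy, hpow]
      exact mul_mem (mul_mem hxQ hyQ) (zpow_mem hyQ k)
  have hwN : w ∈ Subgroup.normalizer (Q : Set G) := by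
    rw [Subgroup.mem_normalizer_iff]
    refine fun h => ⟨hconj h, fun hh => ?_⟩
    have := hconj _ (hconj _ hh)
    have h3 : w * (w * (w * h * w⁻¹) * w⁻¹) * w⁻¹ = w ^ 3 * h * (w ^ 3)⁻¹ := by
      simp only [pow_succ, pow_zero, one_mul, mul_inv_rev, mul_assoc]
    rwa [h3, hw, one_mul, inv_one, mul_one] at this
  -- the order of `w` divides three, while that of an element of `Q` divides eight
  have hwQ : w ∉ Q := fun hwQ => by
    have h8 : w ^ 8 = 1 := by
      have := pow_card_eq_one' (x := (⟨w, hwQ⟩ : Q))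
      rw [hQcard] at this
      exact congrArg Subtype.val this
    have h1 : w = 1 := by
      calc w = (w ^ 3) ^ 3 * (w ^ 8)⁻¹ := by group
        _ = 1 := by rw [hw, h8]; simp
    rw [h1, one_mul, inv_one, mul_one] at hwx
    rw [← hwx] at hxy
    have := mul_left_cancel hxy
    exact hx2 (by rw [sq, mul_eq_one_iff_eq_inv, ← this])
  -- `T` is the preimage in the normalizer of `Q` of the subgroup of order three generated by `w`
  let N := Subgroup.normalizer (Q : Set G)
  let QN := Q.subgroupOf N
  have : QN.Normal := Subgroup.normal_in_normalizer
  let π := QuotientGroup.mk' QN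
  let wN : N := ⟨w, hwN⟩
  let C := Subgroup.zpowers (π wN)
  have hπ3 : π wN ^ 3 = 1 := by
    rw [← map_pow, show wN ^ 3 = 1 from Subtype.ext hw, map_one]
  let T := C.comap π
  let φ : T →* C := π.subgroupComap C
  have hj : Function.Injective (N.subtype.comp T.subtype) :=
    N.subtype_injective.comp T.subtype_injective
  have hker : φ.ker.map (N.subtype.comp T.subtype) = Q := by
    ext h
    constructor
    · rintro ⟨t, ht, rfl⟩
      have : π t.1 = 1 := congrArg Subtype.val ht
      exact (QuotientGroup.eq_one_iff t.1).1 this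
    · intro hh
      have hπ : π ⟨h, Subgroup.le_normalizer hh⟩ = 1 := (QuotientGroup.eq_one_iff _).2 hh
      exact ⟨⟨⟨h, Subgroup.le_normalizer hh⟩, by
        rw [Subgroup.mem_comap, hπ]
        exact one_mem C⟩, Subtype.ext hπ, rfl⟩
  let hC : CommGroup C :=
    { (inferInstance : Group C) with
      mul_comm := by
        rintro ⟨_, k, rfl⟩ ⟨_, l, rfl⟩
        exact Subtype.ext (zpow_mul_comm _ k l) }
  refine ⟨T, C, inferInstance, hC, N.subtype.comp T.subtype, φ, hj, ?_, ?_, ?_⟩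
  · rw [← hQcard, ← hker]
    exact Nat.card_congr (φ.ker.equivMapOfInjective _ hj).toEquiv
  · rintro ⟨c, k, rfl⟩
    refine Subtype.ext ?_
    change (π wN ^ k) ^ 3 = 1
    rw [← zpow_natCast, zpow_comm, zpow_natCast, hπ3, one_zpow]
  · refine ⟨⟨wN, Subgroup.mem_zpowers _⟩, fun h => hwQ ?_⟩
    exact (QuotientGroup.eq_one_iff wN).1 (congrArg Subtype.val h)

open Matrix in
/-- A solution of `a ^ 2 + b ^ 2 = -1` identifies the `2 × 2` matrices with Hamilton's quaternions.
The units `i = !![0, 1; -1, 0]`, `j = !![a, b; b, -a]` generate a quaternion group, and the unit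
`(-1 - i - j - i * j) / 2` of order three permutes `i`, `j`, `i * j` cyclically. -/
theorem exists_hom_specialLinearGroup_card_ker_eq_eight.{u} {F : Type u} [Field F]
    (h2 : (2 : F) ≠ 0) {a b : F} (hab : a ^ 2 + b ^ 2 = -1) :
    ∃ (T C : Type u) (_ : Group T) (_ : CommGroup C) (j : T →* SpecialLinearGroup (Fin 2) F)
      (φ : T →* C), Function.Injective j ∧ Nat.card φ.ker = 8 ∧ (∀ c : C, c ^ 3 = 1) ∧
        ∃ t, φ t ≠ 1 := by
  let x : SpecialLinearGroup (Fin 2) F := ⟨!![0, 1; -1, 0], by simp [det_fin_two]⟩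
  let y : SpecialLinearGroup (Fin 2) F := ⟨!![a, b; b, -a], by
    rw [det_fin_two_of]
    linear_combination -hab⟩
  let w : SpecialLinearGroup (Fin 2) F :=
    ⟨!![(-1 - a - b) / 2, (-1 - b + a) / 2; (1 - b + a) / 2, (-1 + a + b) / 2], by
      rw [det_fin_two_of]
      grind⟩
  let z : SpecialLinearGroup (Fin 2) F := ⟨!![-1, 0; 0, -1], by simp [det_fin_two]⟩
  have key : ∀ {p q r s p' q' r' s' : F}, p = p' → q = q' → r = r' → s = s' →
      !![p, q; r, s] = !![p', q'; r', s'] := by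
    rintro _ _ _ _ _ _ _ _ rfl rfl rfl rfl
    rfl
  have hxx : x * x = z := Subtype.ext ((Matrix.mul_fin_two ..).trans
    (key (by ring) (by ring) (by ring) (by ring)))
  have hyy : y * y = z := Subtype.ext ((Matrix.mul_fin_two ..).trans
    (key (by grind) (by ring) (by ring) (by grind)))
  have hzz : z * z = 1 := Subtype.ext ((Matrix.mul_fin_two ..).trans
    ((key (by ring) (by ring) (by ring) (by ring)).trans Matrix.one_fin_two.symm))
  have hz1 : z ≠ 1 := fun h => h2 (by
    have : (-1 : F) = 1 := congrFun₂ (congrArg Subtype.val h) 0 0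
    linear_combination -this)
  have hxy : (x * y).1 = !![b, -a; -a, -b] := (Matrix.mul_fin_two ..).trans
    (key (by ring) (by ring) (by ring) (by ring))
  have hxyx : x * y * x = y := Subtype.ext ((congrArg (· * x.1) hxy).trans
    ((Matrix.mul_fin_two ..).trans (key (by ring) (by ring) (by ring) (by ring))))
  have hwx : w * x = y * w := Subtype.ext ((Matrix.mul_fin_two ..).trans
    ((key (by grind) (by grind) (by grind) (by grind)).trans (Matrix.mul_fin_two ..).symm))
  have hwy : w * y = x * y * w := Subtype.ext ((Matrix.mul_fin_two ..).trans
    ((key (by grind) (by grind) (by grind) (by grind)).trans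
      ((Matrix.mul_fin_two ..).symm.trans (congrArg (· * w.1) hxy.symm))))
  have hww : (w * w).1 =
      !![(-1 + a + b) / 2, (1 + b - a) / 2; (-1 + b - a) / 2, (-1 - a - b) / 2] :=
    (Matrix.mul_fin_two ..).trans (key (by grind) (by grind) (by grind) (by grind))
  have hw : w ^ 3 = 1 := by
    rw [pow_succ, sq]
    exact Subtype.ext ((congrArg (· * w.1) hww).trans ((Matrix.mul_fin_two ..).trans
      ((key (by grind) (by grind) (by grind) (by grind)).trans Matrix.one_fin_two.symm)))
  refine exists_hom_card_ker_eq_eight (x := x) (y := y) (w := w) ?_ ?_ ?_ ?_ hw ?_ ?_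
  · rw [show x ^ 4 = (x * x) * (x * x) by rw [← sq (x * x), ← sq x, ← pow_mul], hxx, hzz]
  · rw [sq, hxx, hyy]
  · rw [eq_mul_inv_iff_mul_eq, hxyx]
  · rwa [sq, hxx]
  · rw [hwx, mul_inv_cancel_right]
  · rw [hwy, mul_inv_cancel_right]

theorem FiniteField.exists_sq_add_sq_eq_neg_one (F : Type*) [Field F] [Finite F] :
    ∃ a b : F, a ^ 2 + b ^ 2 = -1 := by
  obtain ⟨p, hp⟩ := CharP.exists F
  have : NeZero p := ⟨CharP.char_ne_zero_of_finite F p⟩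
  obtain ⟨a, b, hab⟩ := CharP.sq_add_sq F p (-1)
  exact ⟨a, b, by simpa using hab⟩

/-! ### The projective symplectic groups of degree divisible by six -/

namespace SymplecticGroup

open Matrix

variable {ι F : Type*} [Fintype ι] [DecidableEq ι] [Field F]

/-- The wreath product `Q₈ ≀ Sym(ι)` has odd index in the symplectic group when `q ≡ ±3 mod 8`. -/
theorem odd_index_map_kerWreath [Finite F] (hq : Nat.card F % 8 = 3 ∨ Nat.card F % 8 = 5)
    {T C : Type*} [Group T] [CommGroup C] {j : T →* SpecialLinearGroup (Fin 2) F}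
    (hj : Function.Injective j) (φ : T →* C) (hφ : Nat.card φ.ker = 8) :
    Odd ((PermWreath.kerWreath (ι := ι) φ).map (wreathHom j)).index := by
  set H := (PermWreath.kerWreath (ι := ι) φ).map (wreathHom j) with hH
  have hcard : Nat.card H = 8 ^ Fintype.card ι * (Fintype.card ι).factorial := by
    rw [← hφ, ← PermWreath.card_kerWreath]
    exact Nat.card_congr (Subgroup.equivMapOfInjective _ _ (wreathHom_injective hj)).toEquiv.symm
  have hval := congrArg (padicValNat 2) H.index_mul_card
  have hidx : H.index ≠ 0 := Subgroup.index_ne_zero_of_finite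
  rw [padicValNat_two_card hq, hcard, padicValNat.mul hidx (by positivity),
    padicValNat.mul (by positivity) (by positivity), show (8 : ℕ) = 2 ^ 3 by norm_num, ← pow_mul,
    padicValNat.prime_pow] at hval
  have h0 : padicValNat 2 H.index = 0 := by omega
  rw [← Nat.not_even_iff_odd, even_iff_two_dvd]
  intro hdvd
  have := one_le_padicValNat_of_dvd hidx hdvd
  omega

end SymplecticGroup

theorem mainTheorem1 (n : ℕ) (hn : 0 < n) (q : ℕ) (hq : q % 8 = 3 ∨ q % 8 = 5)
    (F : Type*) [Field F] [Finite F] (hF : Nat.card F = q) :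
    IsSimpleGroup (ProjectiveSymplecticGroup (3 * n) F) ∧
      ∃ H : Subgroup (ProjectiveSymplecticGroup (3 * n) F), Odd H.index ∧ ¬ H.IsPronormal := by
  subst hF
  have h2 : (2 : F) ≠ 0 := fun h => by
    have hord : addOrderOf (1 : F) = 2 :=
      addOrderOf_eq_prime (by rw [two_nsmul, one_add_one_eq_two, h]) one_ne_zero
    have := addOrderOf_dvd_natCard (1 : F)
    rw [hord] at this
    omega
  have : NeZero (3 * n) := ⟨by omega⟩
  have : Nontrivial (Fin (3 * n)) := Fin.nontrivial_iff_two_le.2 (by omega)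
  refine ⟨SymplecticGroup.isSimpleGroup_quotient_center h2, ?_⟩
  obtain ⟨a, b, hab⟩ := FiniteField.exists_sq_add_sq_eq_neg_one F
  obtain ⟨T, C, _, _, j, φ, hj, hφ, hC, ht⟩ :=
    exists_hom_specialLinearGroup_card_ker_eq_eight h2 hab
  refine ⟨(PermWreath.kerWreath φ).map ((QuotientGroup.mk' _).comp
    (SymplecticGroup.wreathHom j)), ?_, fun h => ?_⟩
  · rw [← Subgroup.map_map]
    exact (SymplecticGroup.odd_index_map_kerWreath hq hj φ hφ).of_dvd_nat
      (Subgroup.index_map_dvd _ (QuotientGroup.mk'_surjective _))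
  · refine PermWreath.not_isPronormal_kerWreath φ ht (fun c => ?_)
      (h.of_map _ (SymplecticGroup.ker_mk'_comp_wreathHom_le j hj φ hC))
    rw [Fintype.card_fin, pow_mul, hC, one_pow]
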